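/- Let $(X,d)$ be a compact metric space, equipped with its Borel $\sigma$-algebra, and let $T:X\to X$ be continuous. For $n\ge 1$ put $d_n(x,y)=\max_{0\le k\le n-1} d(T^kx,T^ky)$, $B_n(x,\epsilon)=\{y: d_n(x,y)<\epsilon\}$ and $\overline B_n(x,\epsilon)=\{y: d_n(x,y)\le\epsilon\}$. Let $M(X)$ be the set of Borel probability measures on $X$. For $\mu\in M(X)$ the upper (Brin–Katok) entropy is $$\overline h_\mu(T)=\int \lim_{\epsilon\to0}\limsup_{n\to\infty}\Big(-\frac1n\log\mu(B_n(x,\epsilon))\Big)\,d\mu(x)\in[0,\infty],\qquad -\log 0=\infty.$$ For $Z\subseteq X$, $s\ge0$, $N\in\mathbb N$ and $\epsilon>0$ let $$P^s_{N,\epsilon}(Z)=\sup\sum_i e^{-sn_i},$$ the supremum over all finite or countable pairwise disjoint families $\{\overline B_{n_i}(x_i,\epsilon)\}$ with $x_i\in Z$ and $n_i\ge N$. Let $$P^s_\epsilon(Z)=\lim_{N\to\infty}P^s_{N,\epsilon}(Z),\qquad \mathcal P^s_\epsilon(Z)=\inf\Big\{\sum_{i=1}^\infty P^s_\epsilon(Z_i):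 Z\subseteq\bigcup_{i=1}^\infty Z_i\Big\}.$$ There is a critical value $h^P_{\mathrm{top}}(T,Z,\epsilon)\in[0,\infty]$ with $\mathcal P^s_\epsilon(Z)=\infty$ for $0\le s<h^P_{\mathrm{top}}(T,Z,\epsilon)$ and $\mathcal P^s_\epsilon(Z)=0$ for $s>h^P_{\mathrm{top}}(T,Z,\epsilon)$. The packing topological entropy of $Z$ is $h^P_{\mathrm{top}}(T,Z)=\lim_{\epsilon\to0}h^P_{\mathrm{top}}(T,Z,\epsilon)$, so that $h^P_{\mathrm{top}}(T,\emptyset)=0$. A subset of $X$ is called analytic if it is empty or a continuous image of $\mathbb N^{\mathbb N}$. Then the following hold. (i) If $K\subseteq X$ is non-empty and compact, then $$h^P_{\mathrm{top}}(T,K)=\sup\{\overline h_\mu(T):\mu\in M(X),\ \mu(K)=1\}.$$ (ii) If $Z\subseteq X$ is analytic, then $$h^P_{\mathrm{top}}(T,Z)=\sup\{h^P_{\mathrm{top}}(T,K): K\subseteq Z,\ K\text{ compact}\}.$$ (iii) If $Z\subseteq X$ is Borel, then $h^P_{\mathrm{top}}(T,Z)\ge\sup\{\overline h_\mu(T):\mu\in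 M(X),\ \mu(Z)=1\}$, where the supremum of the empty set is $0$. -/

import Mathlib

open MeasureTheory Filter Topology
open scoped NNReal ENNReal

noncomputable section

namespace PackingEntropy

variable {X : Type*} [MetricSpace X]

/-- The `n`-th Bowen metric `d_n(x, y) = max {d(T^k x, T^k y) : k = 0, …, n - 1}` (for `n ≥ 1`). -/
def bowenDist (T : X → X) (n : ℕ) (x y : X) : ℝ :=
  ((Finset.range n).sup fun k => nndist (T^[k] x) (T^[k] y) : ℝ≥0)

/-- The open ball `B_n(x, ε)` of the Bowen metric `d_n`. -/
def bowenBall (T : X → X) (n : ℕ) (x : X) (ε : ℝ) : Set X :=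
  {y | bowenDist T n x y < ε}

/-- The closed ball of centre `x` and radius `ε` of the Bowen metric `d_n`. -/
def closedBowenBall (T : X → X) (n : ℕ) (x : X) (ε : ℝ) : Set X :=
  {y | bowenDist T n x y ≤ ε}

/-! ### Upper Brin–Katok entropy of a measure -/

/-- `limsup_{n → ∞} -(1/n) log μ(B_n(x, ε))`, with values in `[0, ∞]` (and `-log 0 = ∞`).
Here `μ` is meant to be a probability measure, so that `-log μ(B) ≥ 0`. -/
def upperLocalEntropyAt [MeasurableSpace X] (T : X → X) (μ : Measure X) (x : X) (ε : ℝ) : ℝ≥0∞ :=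
  limsup (fun n : ℕ => (-ENNReal.log (μ (bowenBall T n x ε))).toENNReal / (n : ℝ≥0∞)) atTop

/-- The upper local entropy of `μ` at `x`, the limit of `upperLocalEntropyAt T μ x ε` as `ε → 0`.
By monotonicity in `ε` it is a supremum, see `tendsto_upperLocalEntropyAt`. -/
def upperLocalEntropy [MeasurableSpace X] (T : X → X) (μ : Measure X) (x : X) : ℝ≥0∞ :=
  ⨆ (ε : ℝ) (_ : 0 < ε), upperLocalEntropyAt T μ x ε

/-- The measure-theoretical upper entropy of `μ`, the integral of its upper local entropy. -/
def upperEntropy [MeasurableSpace X] (T : X → X) (μ : Measure X) : ℝ≥0∞ :=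
  ∫⁻ x, upperLocalEntropy T μ x ∂μ

/-! ### Packing topological entropy of a set -/

/-- `P^s_{N,ε}(Z)`: the supremum of `∑ exp(-s n_i)` over the finite or countable pairwise disjoint
families of closed balls of radius `ε` in the metrics `d_{n_i}`, with centres `x_i ∈ Z` and
`n_i ≥ N`. Balls contain their centres, so a disjoint family has no repetitions and is given by
its set of pairs `(n_i, x_i)`. -/
def packingPre (T : X → X) (s : ℝ) (N : ℕ) (ε : ℝ) (Z : Set X) : ℝ≥0∞ :=
  ⨆ (F : Set (ℕ × X)) (_ : F.Countable) (_ : ∀ p ∈ F, N ≤ p.1 ∧ p.2 ∈ Z)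
    (_ : F.PairwiseDisjoint fun p => closedBowenBall T p.1 p.2 ε),
    ∑' p : F, ENNReal.ofReal (Real.exp (-s * (p : ℕ × X).1))

/-- `P^s_ε(Z)`, the limit of `P^s_{N,ε}(Z)` as `N → ∞`. As these numbers are nonincreasing in `N`,
it is an infimum, see `tendsto_packingPre`. -/
def packingPreLim (T : X → X) (s : ℝ) (ε : ℝ) (Z : Set X) : ℝ≥0∞ :=
  ⨅ N : ℕ, packingPre T s N ε Z

/-- `𝒫^s_ε(Z)`, the infimum of `∑ P^s_ε(Z_i)` over the countable covers `(Z_i)` of `Z`. -/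
def packingMeas (T : X → X) (s : ℝ) (ε : ℝ) (Z : Set X) : ℝ≥0∞ :=
  ⨅ (C : ℕ → Set X) (_ : Z ⊆ ⋃ i, C i), ∑' i, packingPreLim T s ε (C i)

/-- The critical value in `[0, ∞]` of the parameter `s ≥ 0` at which `𝒫^s_ε(Z)` jumps from `∞`
to `0`, see `packingMeas_eq_zero` and `packingMeas_eq_top`. -/
def packingEntropyAt (T : X → X) (ε : ℝ) (Z : Set X) : ℝ≥0∞ :=
  ⨅ (s : ℝ≥0) (_ : packingMeas T s ε Z = 0), (s : ℝ≥0∞)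

/-- The packing topological entropy of `Z`, the limit of `packingEntropyAt T ε Z` as `ε → 0`.
By monotonicity in `ε` it is a supremum, see `tendsto_packingEntropyAt`. -/
def packingEntropy (T : X → X) (Z : Set X) : ℝ≥0∞ :=
  ⨆ (ε : ℝ) (_ : 0 < ε), packingEntropyAt T ε Z

/-! ### The limits and the critical value in the definitions exist -/

theorem tendsto_of_anti {f : ℝ → ℝ≥0∞} (hf : ∀ a b, a ≤ b → f b ≤ f a) :
    Tendsto f (𝓝[>] 0) (𝓝 (⨆ (ε : ℝ) (_ : 0 < ε), f ε)) := by
  rw [tendsto_order]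
  constructor
  · intro a ha
    obtain ⟨ε, hε⟩ := lt_iSup_iff.1 ha
    obtain ⟨h0, hε⟩ := lt_iSup_iff.1 hε
    filter_upwards [Ioc_mem_nhdsGT h0] with δ hδ
    exact hε.trans_le (hf _ _ hδ.2)
  · intro a ha
    filter_upwards [self_mem_nhdsWithin] with δ hδ
    exact (le_iSup₂ (f := fun (ε : ℝ) (_ : 0 < ε) => f ε) δ hδ).trans_lt ha

theorem tendsto_upperLocalEntropyAt [MeasurableSpace X] (T : X → X) (μ : Measure X) (x : X) :
    Tendsto (upperLocalEntropyAt T μ x) (𝓝[>] 0) (𝓝 (upperLocalEntropy T μ x)) := by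
  refine tendsto_of_anti fun a b hab => ?_
  refine limsup_le_limsup (Eventually.of_forall fun n => ?_)
  refine ENNReal.div_le_div_right (EReal.toENNReal_le_toENNReal ?_) _
  refine EReal.neg_le_neg_iff.2 (ENNReal.log_monotone (measure_mono fun y hy => ?_))
  exact lt_of_lt_of_le hy hab

theorem packingPre_anti (T : X → X) (s ε : ℝ) (Z : Set X) :
    Antitone fun N => packingPre T s N ε Z := by
  intro M N h
  refine iSup_mono fun F => iSup_mono fun _ => iSup_le fun h2 => ?_
  exact le_iSup_of_le (fun p hp => ⟨h.trans (h2 p hp).1, (h2 p hp).2⟩) le_rfl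

theorem tendsto_packingPre (T : X → X) (s ε : ℝ) (Z : Set X) :
    Tendsto (fun N => packingPre T s N ε Z) atTop (𝓝 (packingPreLim T s ε Z)) :=
  tendsto_atTop_iInf (packingPre_anti T s ε Z)

theorem packingPre_mul_le (T : X → X) {s t : ℝ} (hst : s ≤ t) (N : ℕ) (ε : ℝ) (Z : Set X) :
    ENNReal.ofReal (Real.exp ((t - s) * N)) * packingPre T t N ε Z ≤ packingPre T s N ε Z := by
  simp only [packingPre, ENNReal.mul_iSup]
  refine iSup_mono fun F => iSup_mono fun _ => iSup_mono fun h2 => iSup_mono fun _ => ?_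
  rw [← ENNReal.tsum_mul_left]
  refine ENNReal.tsum_le_tsum fun p => ?_
  rw [← ENNReal.ofReal_mul (Real.exp_pos _).le, ← Real.exp_add]
  refine ENNReal.ofReal_le_ofReal (Real.exp_le_exp.2 ?_)
  have h : (N : ℝ) ≤ ((p : ℕ × X).1 : ℝ) := by exact_mod_cast (h2 p p.2).1
  nlinarith [mul_le_mul_of_nonneg_left h (sub_nonneg.2 hst)]

theorem packingPreLim_eq_top (T : X → X) {s t : ℝ} (hst : s < t) (ε : ℝ) (Z : Set X)
    (h : packingPreLim T t ε Z ≠ 0) : packingPreLim T s ε Z = ∞ := by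
  have key : ∀ N : ℕ, ENNReal.ofReal (Real.exp ((t - s) * N)) * packingPreLim T t ε Z
      ≤ packingPre T s N ε Z := fun N =>
    (mul_le_mul_right (iInf_le _ N) _).trans (packingPre_mul_le T hst.le N ε Z)
  have h1 : Tendsto (fun N : ℕ => ENNReal.ofReal (Real.exp ((t - s) * N))) atTop (𝓝 ∞) :=
    ENNReal.tendsto_ofReal_atTop.comp (Real.tendsto_exp_atTop.comp
      (tendsto_natCast_atTop_atTop.const_mul_atTop (sub_pos.2 hst)))
  have h2 := ENNReal.Tendsto.mul_const (b := packingPreLim T t ε Z) h1 (Or.inl ENNReal.top_ne_zero)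
  rw [ENNReal.top_mul h] at h2
  exact top_le_iff.1 (le_of_tendsto_of_tendsto' h2 (tendsto_packingPre T s ε Z) key)

theorem packingMeas_eq_top_of_ne_zero (T : X → X) {s t : ℝ} (hst : s < t) (ε : ℝ) (Z : Set X)
    (h : packingMeas T t ε Z ≠ 0) : packingMeas T s ε Z = ∞ := by
  simp only [packingMeas, iInf_eq_top]
  intro C hC
  have h1 : ∑' i, packingPreLim T t ε (C i) ≠ 0 := fun h0 =>
    h (le_antisymm ((iInf₂_le C hC).trans h0.le) (zero_le))
  obtain ⟨i, hi⟩ : ∃ i, packingPreLim T t ε (C i) ≠ 0 := by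
    by_contra! hc
    exact h1 (by simp [hc])
  exact ENNReal.tsum_eq_top_of_eq_top ⟨i, packingPreLim_eq_top T hst ε _ hi⟩

theorem packingMeas_eq_zero (T : X → X) (ε : ℝ) (Z : Set X) (s : ℝ≥0)
    (h : packingEntropyAt T ε Z < s) : packingMeas T s ε Z = 0 := by
  obtain ⟨r, hr⟩ := iInf_lt_iff.1 h
  obtain ⟨h0, hr⟩ := iInf_lt_iff.1 hr
  by_contra hc
  have := packingMeas_eq_top_of_ne_zero T (NNReal.coe_lt_coe.2 (ENNReal.coe_lt_coe.1 hr)) ε Z hc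
  simp [h0] at this

theorem packingMeas_eq_top (T : X → X) (ε : ℝ) (Z : Set X) (s : ℝ≥0)
    (h : s < packingEntropyAt T ε Z) : packingMeas T s ε Z = ∞ := by
  obtain ⟨r, hsr, hr⟩ := ENNReal.lt_iff_exists_nnreal_btwn.1 h
  refine packingMeas_eq_top_of_ne_zero T (NNReal.coe_lt_coe.2 (ENNReal.coe_lt_coe.1 hsr)) ε Z ?_
  exact fun h0 => absurd (iInf₂_le r h0) (not_le.2 hr)

theorem tendsto_packingEntropyAt (T : X → X) (Z : Set X) :
    Tendsto (fun ε => packingEntropyAt T ε Z) (𝓝[>] 0) (𝓝 (packingEntropy T Z)) := by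
  refine tendsto_of_anti fun a b hab => ?_
  have h1 : ∀ (s : ℝ) (W : Set X), packingPreLim T s b W ≤ packingPreLim T s a W := by
    intro s W
    refine iInf_mono fun N => iSup_mono fun F => iSup_mono fun _ => iSup_mono fun _ =>
      iSup_le fun h => le_iSup_of_le ?_ le_rfl
    exact h.mono fun p y hy => le_trans (show bowenDist T p.1 p.2 y ≤ a from hy) hab
  have h2 : ∀ s : ℝ, packingMeas T s b Z ≤ packingMeas T s a Z := fun s =>
    iInf_mono fun C => iInf_mono fun _ => ENNReal.tsum_le_tsum fun i => h1 s (C i)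
  refine le_iInf₂ fun s hs => iInf₂_le s ?_
  exact le_antisymm ((h2 s).trans hs.le) (zero_le)

end PackingEntropy

end

open PackingEntropy

/-! The inequality ≥ for Borel sets is a covering argument. If the upper local entropy of `μ`
exceeds `c > s` on a set `E` of positive outer measure, a Vitali covering at each fixed `n` bounds
the mass of the points whose Bowen ball has mass at most `exp (-c n)` by `exp (-(c - s) n)` times a
packing sum. Borel–Cantelli then forces the packing sums of `E` to be infinite
(`packingPreLim_eq_top_of_lt_upperLocalEntropyAt`).

The converse is a Frostman-type construction. Write the analytic set as the range of a continuous
`φ` on a complete separable metric space `W`. A piece of positive packing measure at exponent `t`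
has infinite packing sums at `s < t`, so it splits into finitely many small, Bowen-separated pieces,
again of positive packing measure, with weights at most `exp (-s n)` (`exists_pmf_split`). Iteration
gives a tree of finite measures (`exists_pmf_tree`). A weak limit is carried by a compact subset of
the range and satisfies `μ (B_n(z, ε)) ≤ exp (-s n)` for arbitrarily large `n` at almost every `z`.
That one compact set serves both the variational principle and the approximation from inside. -/

namespace PackingEntropy

/-! ### Bowen metrics and packing measure as an outer measure. -/

section Bowen

variable {X : Type*} [MetricSpace X]

theorem bowenDist_self (T : X → X) (n : ℕ) (x : X) : bowenDist T n x x = 0 := by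
  simp [bowenDist]

theorem bowenDist_comm (T : X → X) (n : ℕ) (x y : X) : bowenDist T n x y = bowenDist T n y x := by
  simp [bowenDist, nndist_comm]

theorem bowenDist_triangle (T : X → X) (n : ℕ) (x y z : X) :
    bowenDist T n x z ≤ bowenDist T n x y + bowenDist T n y z := by
  rw [bowenDist, bowenDist, bowenDist, ← NNReal.coe_add, NNReal.coe_le_coe]
  refine Finset.sup_le fun k hk => (nndist_triangle _ (T^[k] y) _).trans (add_le_add ?_ ?_)
  · exact Finset.le_sup (f := fun k => nndist (T^[k] x) (T^[k] y)) hk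
  · exact Finset.le_sup (f := fun k => nndist (T^[k] y) (T^[k] z)) hk

theorem bowenDist_mono (T : X → X) {m n : ℕ} (h : m ≤ n) (x y : X) :
    bowenDist T m x y ≤ bowenDist T n x y :=
  NNReal.coe_le_coe.2 (Finset.sup_mono (Finset.range_mono h))

theorem continuous_bowenDist {T : X → X} (hT : Continuous T) (n : ℕ) :
    Continuous fun p : X × X => bowenDist T n p.1 p.2 := by
  refine NNReal.continuous_coe.comp (Continuous.finset_sup_apply fun k _ => ?_)
  exact ((hT.iterate k).comp continuous_fst).nndist ((hT.iterate k).comp continuous_snd)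

theorem isOpen_bowenBall {T : X → X} (hT : Continuous T) (n : ℕ) (x : X) (ε : ℝ) :
    IsOpen (bowenBall T n x ε) :=
  isOpen_lt ((continuous_bowenDist hT n).comp (Continuous.prodMk_right x)) continuous_const

theorem packingPre_mono (T : X → X) (s : ℝ) (N : ℕ) (ε : ℝ) {Y Z : Set X} (h : Y ⊆ Z) :
    packingPre T s N ε Y ≤ packingPre T s N ε Z :=
  iSup_mono fun _ => iSup_mono fun _ => iSup_le fun h2 =>
    le_iSup_of_le (fun p hp => ⟨(h2 p hp).1, h (h2 p hp).2⟩) le_rfl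

theorem packingPreLim_mono (T : X → X) (s : ℝ) (ε : ℝ) {Y Z : Set X} (h : Y ⊆ Z) :
    packingPreLim T s ε Y ≤ packingPreLim T s ε Z :=
  iInf_mono fun N => packingPre_mono T s N ε h

theorem packingPreLim_empty (T : X → X) (s : ℝ) (ε : ℝ) : packingPreLim T s ε ∅ = 0 := by
  refine le_antisymm (iInf_le_of_le 0 ?_) zero_le
  refine iSup_le fun F => iSup_le fun _ => iSup_le fun h => iSup_le fun _ => ?_
  obtain rfl : F = ∅ := Set.eq_empty_of_forall_notMem fun p hp => (h p hp).2
  simp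

/-- `packingMeas` as an outer measure. -/
noncomputable def packingOuterMeasure (T : X → X) (s : ℝ) (ε : ℝ) : OuterMeasure X :=
  OuterMeasure.ofFunction (packingPreLim T s ε) (packingPreLim_empty T s ε)

theorem packingOuterMeasure_apply (T : X → X) (s : ℝ) (ε : ℝ) (Z : Set X) :
    packingOuterMeasure T s ε Z = packingMeas T s ε Z :=
  rfl

theorem packingMeas_le_packingPreLim (T : X → X) (s : ℝ) (ε : ℝ) (Z : Set X) :
    packingMeas T s ε Z ≤ packingPreLim T s ε Z :=
  OuterMeasure.ofFunction_le (m_empty := packingPreLim_empty T s ε) Z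

theorem packingMeas_mono (T : X → X) (s : ℝ) (ε : ℝ) {Y Z : Set X} (h : Y ⊆ Z) :
    packingMeas T s ε Y ≤ packingMeas T s ε Z :=
  measure_mono (μ := packingOuterMeasure T s ε) h

theorem packingEntropy_mono (T : X → X) {Y Z : Set X} (h : Y ⊆ Z) :
    packingEntropy T Y ≤ packingEntropy T Z :=
  iSup₂_mono fun ε _ => iInf_mono fun s => le_iInf fun hs =>
    iInf_le_of_le (le_antisymm ((packingMeas_mono T s ε h).trans hs.le) zero_le) le_rfl

end Bowen

/-! ### Logarithmic rates versus exponential bounds. -/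

theorem coe_le_neg_log_div_of_le {m : ℝ≥0∞} {c : ℝ≥0} {n : ℕ} (hn : n ≠ 0)
    (h : m ≤ ENNReal.ofReal (Real.exp (-c * n))) :
    (c : ℝ≥0∞) ≤ (-ENNReal.log m).toENNReal / (n : ℝ≥0∞) := by
  rw [ENNReal.le_div_iff_mul_le (Or.inl (by simpa using hn)) (Or.inl (by simp))]
  have h1 : (c : ℝ≥0∞) * n = EReal.toENNReal ((c * n : ℝ) : EReal) := by
    rw [EReal.real_coe_toENNReal, ENNReal.ofReal_mul (NNReal.coe_nonneg c)]
    simp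
  rw [h1]
  refine EReal.toENNReal_le_toENNReal (EReal.le_neg.2 ?_)
  rw [← EReal.coe_neg, ← neg_mul, ← Real.log_exp (-(c : ℝ) * n),
    ← ENNReal.log_ofReal_of_pos (Real.exp_pos _)]
  exact ENNReal.log_monotone h

theorem le_of_coe_lt_neg_log_div {m : ℝ≥0∞} {c : ℝ≥0} {n : ℕ} (hn : n ≠ 0)
    (h : (c : ℝ≥0∞) < (-ENNReal.log m).toENNReal / (n : ℝ≥0∞)) :
    m ≤ ENNReal.ofReal (Real.exp (-c * n)) := by
  rw [ENNReal.lt_div_iff_mul_lt (Or.inl (by simpa using hn)) (Or.inl (by simp))] at h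
  have h0 : 0 ≤ -ENNReal.log m := (EReal.toENNReal_pos_iff.1 (zero_le.trans_lt h)).le
  have h1 : (c : ℝ≥0∞) * n = ENNReal.ofReal (c * n) := by
    rw [ENNReal.ofReal_mul (NNReal.coe_nonneg c)]
    simp
  have h2 := EReal.coe_ennreal_le_coe_ennreal_iff.2 h.le
  rw [EReal.coe_toENNReal h0, h1, EReal.coe_ennreal_ofReal, max_eq_left (by positivity)] at h2
  rw [← ENNReal.log_le_log_iff, ENNReal.log_ofReal_of_pos (Real.exp_pos _), Real.log_exp, neg_mul,
    EReal.coe_neg]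
  exact EReal.le_neg.1 h2

theorem upperLocalEntropyAt_anti {X : Type*} [MetricSpace X] [MeasurableSpace X] (T : X → X) (μ : Measure X) (x : X) {a b : ℝ} (hab : a ≤ b) :
    upperLocalEntropyAt T μ x b ≤ upperLocalEntropyAt T μ x a := by
  refine limsup_le_limsup (Eventually.of_forall fun n => ?_)
  refine ENNReal.div_le_div_right (EReal.toENNReal_le_toENNReal ?_) _
  refine EReal.neg_le_neg_iff.2 (ENNReal.log_monotone (measure_mono fun y hy => ?_))
  exact lt_of_lt_of_le hy hab

/-! ### Upper entropy is bounded by packing entropy. -/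

section UpperBound

variable {X : Type*} [MetricSpace X] [CompactSpace X] [MeasurableSpace X]

/-- A maximal disjoint family of closed `ε / 3`-balls at the single time `n` is admissible for the
packing sum, and the concentric open `ε`-balls cover `E`. No measurability of `E` is needed. -/
theorem exp_mul_measure_le_packingPre {T : X → X} (hT : Continuous T) (μ : Measure X)
    (s c : ℝ) {N n : ℕ} (hn : N ≤ n) {ε : ℝ} (hε : 0 < ε) (E : Set X)
    (hE : ∀ x ∈ E, μ (bowenBall T n x ε) ≤ ENNReal.ofReal (Real.exp (-c * n))) :
    μ E ≤ ENNReal.ofReal (Real.exp (-(c - s) * n)) * packingPre T s N (ε / 3) E := by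
  have hself : ∀ x, x ∈ bowenBall T n x (ε / 3) := fun x => by
    simp [bowenBall, bowenDist_self, hε]
  have hsub : ∀ x, bowenBall T n x (ε / 3) ⊆ closedBowenBall T n x (ε / 3) := fun x y hy =>
    le_of_lt (show bowenDist T n x y < ε / 3 from hy)
  -- All sizes equal `1`, so the size comparison is vacuous: the output is a disjoint subfamily that
  -- every ball of the family meets. Centres of meeting balls are within `2 * ε / 3 < ε`.
  obtain ⟨u, huE, hu, hcov⟩ := Vitali.exists_disjoint_subfamily_covering_enlargement
    (fun x => closedBowenBall T n x (ε / 3)) E (fun _ => 1) 2 one_lt_two (fun _ _ => zero_le_one) 1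
    (fun _ _ => le_rfl) (fun x _ => ⟨x, hsub x (hself x)⟩)
  have hcount : u.Countable :=
    (hu.mono fun x => hsub x).countable_of_isOpen (fun x _ => isOpen_bowenBall hT n x _)
      (fun x _ => ⟨x, hself x⟩)
  have hcover : E ⊆ ⋃ x ∈ u, bowenBall T n x ε := by
    intro x hx
    obtain ⟨y, hy, ⟨z, hzx, hzy⟩, -⟩ := hcov x hx
    refine Set.mem_biUnion hy ?_
    have h1 : bowenDist T n x z ≤ ε / 3 := hzx
    have h2 : bowenDist T n y z ≤ ε / 3 := hzy
    have h3 := bowenDist_triangle T n y z x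
    rw [bowenDist_comm T n z x] at h3
    show bowenDist T n y x < ε
    linarith
  have hpre : ∑' _ : u, ENNReal.ofReal (Real.exp (-s * n)) ≤ packingPre T s N (ε / 3) E := by
    have hinj : Function.Injective (fun x : X => (n, x)) := Prod.mk_right_injective n
    refine le_trans (le_of_eq ?_) (le_iSup₂_of_le ((fun x : X => (n, x)) '' u) (hcount.image _)
      (le_iSup₂_of_le ?_ ?_ le_rfl))
    · exact (tsum_image (fun p : ℕ × X => ENNReal.ofReal (Real.exp (-s * p.1))) hinj.injOn).symm
    · rintro _ ⟨x, hx, rfl⟩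
      exact ⟨hn, huE hx⟩
    · rintro _ ⟨x, hx, rfl⟩ _ ⟨y, hy, rfl⟩ hxy
      exact hu hx hy (fun h => hxy (by rw [h]))
  calc μ E ≤ ∑' x : u, μ (bowenBall T n x ε) :=
        (measure_mono hcover).trans (measure_biUnion_le μ hcount _)
    _ ≤ ∑' x : u, ENNReal.ofReal (Real.exp (-(c - s) * n)) * ENNReal.ofReal (Real.exp (-s * n)) := by
        refine ENNReal.tsum_le_tsum fun x => (hE x (huE x.2)).trans (le_of_eq ?_)
        rw [← ENNReal.ofReal_mul (Real.exp_pos _).le, ← Real.exp_add]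
        ring_nf
    _ ≤ _ := by
        rw [ENNReal.tsum_mul_left]
        gcongr

/-- Were some packing sum finite, the sets of points with a light ball at time `n` would have masses
bounded by a geometric series of ratio `exp (-(c - s))`. By Borel–Cantelli almost no point would lie
in infinitely many of them, yet every point of `E` does. -/
theorem packingPreLim_eq_top_of_lt_upperLocalEntropyAt {T : X → X} (hT : Continuous T)
    (μ : Measure X) {s c : ℝ≥0} (hsc : s < c) {ε : ℝ} (hε : 0 < ε) {E : Set X} (hμE : μ E ≠ 0)
    (hE : ∀ x ∈ E, c < upperLocalEntropyAt T μ x ε) : packingPreLim T s (ε / 3) E = ∞ := by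
  by_contra htop
  obtain ⟨N, hN⟩ := iInf_lt_iff.1 (lt_top_iff_ne_top.2 htop)
  let p : ℕ → X → Prop := fun n x =>
    N ≤ n ∧ x ∈ E ∧ μ (bowenBall T n x ε) ≤ ENNReal.ofReal (Real.exp (-c * n))
  have hsum : ∑' n, μ {x | p n x} ≠ ∞ := by
    have hle : ∀ n, μ {x | p n x} ≤
        ENNReal.ofReal (Real.exp (-(c - s))) ^ n * packingPre T s N (ε / 3) E := by
      intro n
      by_cases hn : N ≤ n
      · refine (exp_mul_measure_le_packingPre hT μ s c hn hε _ fun x hx => hx.2.2).trans ?_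
        rw [← ENNReal.ofReal_pow (Real.exp_pos _).le, ← Real.exp_nat_mul, mul_comm (n : ℝ)]
        gcongr
        exact packingPre_mono T s N _ fun x hx => hx.2.1
      · simp [p, hn]
    refine ne_top_of_le_ne_top ?_ (ENNReal.tsum_le_tsum hle)
    rw [ENNReal.tsum_mul_right, ENNReal.tsum_geometric]
    refine ENNReal.mul_ne_top (ENNReal.inv_ne_top.2 (tsub_pos_of_lt ?_).ne') hN.ne
    rw [ENNReal.ofReal_lt_one, Real.exp_lt_one_iff, neg_lt_zero, sub_pos]
    exact hsc
  refine hμE (measure_mono_null (fun x hx => ?_) (measure_setOfPred_frequently_eq_zero hsum))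
  have h1 := frequently_lt_of_lt_limsup (by isBoundedDefault) (hE x hx)
  refine (h1.and_eventually (eventually_ge_atTop (max N 1))).mono fun n hn => ?_
  refine ⟨(le_max_left _ _).trans hn.2, hx, le_of_coe_lt_neg_log_div ?_ hn.1⟩
  exact Nat.one_le_iff_ne_zero.1 ((le_max_right _ _).trans hn.2)

theorem upperEntropy_le_packingEntropy {T : X → X} (hT : Continuous T) (μ : Measure X)
    [IsProbabilityMeasure μ] {Z : Set X} (hZ : MeasurableSet Z) (hμZ : μ Z = 1) :
    upperEntropy T μ ≤ packingEntropy T Z := by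
  by_contra! hlt
  obtain ⟨s, hs, hlt⟩ := ENNReal.lt_iff_exists_nnreal_btwn.1 hlt
  obtain ⟨c, hsc, hc⟩ := ENNReal.lt_iff_exists_nnreal_btwn.1 hlt
  rw [ENNReal.coe_lt_coe] at hsc
  -- As `μ` has total mass one, an integral above `c` needs an integrand above `c` on a non-null
  -- set. Fixing a scale `1 / (k + 1)` and then a piece `C i` of a cover with finite packing sum
  -- keeps the set non-null.
  have hA : μ {x | c < upperLocalEntropy T μ x} ≠ 0 := by
    intro h0
    refine hc.not_ge ?_
    calc upperEntropy T μ ≤ ∫⁻ _, c ∂μ := by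
          refine lintegral_mono_ae ?_
          filter_upwards [measure_eq_zero_iff_ae_notMem.1 h0] with x hx
          exact not_lt.1 hx
      _ = c := by simp
  have hsub : {x | c < upperLocalEntropy T μ x} ⊆
      ⋃ k : ℕ, {x | c < upperLocalEntropyAt T μ x (1 / (k + 1))} := by
    intro x hx
    obtain ⟨ε, hε⟩ := lt_iSup_iff.1 (show c < upperLocalEntropy T μ x from hx)
    obtain ⟨h0, hε⟩ := lt_iSup_iff.1 hε
    obtain ⟨k, hk⟩ := exists_nat_one_div_lt h0
    exact Set.mem_iUnion.2 ⟨k, hε.trans_le (upperLocalEntropyAt_anti T μ x hk.le)⟩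
  obtain ⟨k, hk⟩ : ∃ k : ℕ, μ {x | c < upperLocalEntropyAt T μ x (1 / (k + 1))} ≠ 0 := by
    by_contra! h0
    exact hA (measure_mono_null hsub (measure_iUnion_null h0))
  have hε : (0 : ℝ) < 1 / (k + 1) := by positivity
  set ε : ℝ := 1 / (k + 1)
  have hmeas : packingMeas T s (ε / 3) Z < ∞ := by
    rw [packingMeas_eq_zero]
    · exact ENNReal.zero_lt_top
    · exact lt_of_le_of_lt (le_iSup₂ (f := fun (ε : ℝ) (_ : 0 < ε) => packingEntropyAt T ε Z)
        (ε / 3) (by positivity)) hs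
  obtain ⟨C, hC⟩ := iInf_lt_iff.1 hmeas
  obtain ⟨hZC, hC⟩ := iInf_lt_iff.1 hC
  have hZ0 : μ Zᶜ = 0 := (prob_compl_eq_zero_iff hZ).2 hμZ
  have hcov : {x | c < upperLocalEntropyAt T μ x ε} ⊆
      Zᶜ ∪ ⋃ i, {x | c < upperLocalEntropyAt T μ x ε} ∩ C i := by
    intro x hx
    by_cases hxZ : x ∈ Z
    · obtain ⟨i, hi⟩ := Set.mem_iUnion.1 (hZC hxZ)
      exact Or.inr (Set.mem_iUnion.2 ⟨i, hx, hi⟩)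
    · exact Or.inl hxZ
  obtain ⟨i, hi⟩ : ∃ i, μ ({x | c < upperLocalEntropyAt T μ x ε} ∩ C i) ≠ 0 := by
    by_contra! h0
    exact hk (measure_mono_null hcov (measure_union_null hZ0 (measure_iUnion_null h0)))
  refine (ENNReal.ne_top_of_tsum_ne_top hC.ne i) (top_le_iff.1 ?_)
  rw [← packingPreLim_eq_top_of_lt_upperLocalEntropyAt hT μ hsc hε hi fun x hx => hx.1]
  exact packingPreLim_mono T s _ Set.inter_subset_right

end UpperBound

/-! ### Splitting a set of positive packing measure. -/

section Splitting

variable {X : Type*} [MetricSpace X]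

/-- By second countability, discarding the points of `F` with a null neighbourhood in `F` removes
only a null set. What remains has positive packing measure at `t`, hence infinite packing sums at `s
< t`, and a finite subfamily already exceeds `1`. -/
theorem exists_finset_pairwiseDisjoint [SecondCountableTopology X] (T : X → X) {s t : ℝ}
    (hst : s < t) (ε : ℝ) {F : Set X} (hF : packingMeas T t ε F ≠ 0) (N : ℕ) :
    ∃ J : Finset (ℕ × X), (∀ p ∈ J, N ≤ p.1 ∧ ∀ U ∈ 𝓝 p.2, packingMeas T t ε (F ∩ U) ≠ 0) ∧
      (J : Set (ℕ × X)).PairwiseDisjoint (fun p => closedBowenBall T p.1 p.2 ε) ∧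
      1 ≤ ∑ p ∈ J, ENNReal.ofReal (Real.exp (-s * p.1)) := by
  simp only [← packingOuterMeasure_apply] at hF ⊢
  set m := packingOuterMeasure T t ε
  set F' : Set X := {x | x ∈ F ∧ ∀ U ∈ 𝓝 x, m (F ∩ U) ≠ 0}
  have hnull : m (F \ F') = 0 := by
    refine measure_null_of_locally_null _ fun x hx => ?_
    obtain ⟨U, hU, h0⟩ : ∃ U ∈ 𝓝 x, m (F ∩ U) = 0 := by
      by_contra! h
      exact hx.2 ⟨hx.1, h⟩
    exact ⟨_, inter_mem_nhdsWithin _ hU,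
      measure_mono_null (Set.inter_subset_inter_left _ Set.sdiff_subset) h0⟩
  have hmF' : m F' ≠ 0 := fun h0 => hF <| measure_mono_null
    (fun x hx => (em (x ∈ F')).imp id fun h => ⟨hx, h⟩) (measure_union_null h0 hnull)
  have htop : packingPreLim T s ε F' = ∞ := by
    refine packingPreLim_eq_top T hst ε F' fun h0 => hmF' ?_
    exact le_antisymm ((packingMeas_le_packingPreLim T t ε F').trans h0.le) zero_le
  have hlt : 1 < packingPre T s N ε F' :=
    (ENNReal.one_lt_top.trans_eq htop.symm).trans_le (iInf_le _ N)
  obtain ⟨S, hS⟩ := lt_iSup_iff.1 hlt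
  obtain ⟨-, hS⟩ := lt_iSup_iff.1 hS
  obtain ⟨hSF, hS⟩ := lt_iSup_iff.1 hS
  obtain ⟨hSd, hS⟩ := lt_iSup_iff.1 hS
  rw [ENNReal.tsum_eq_iSup_sum] at hS
  obtain ⟨J, hJ⟩ := lt_iSup_iff.1 hS
  have hJS : ∀ p ∈ J.map (Function.Embedding.subtype _), p ∈ S := by
    intro p hp
    obtain ⟨q, -, rfl⟩ := Finset.mem_map.1 hp
    exact q.2
  refine ⟨J.map (Function.Embedding.subtype _), fun p hp => ?_, hSd.subset hJS, ?_⟩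
  · exact ⟨(hSF p (hJS p hp)).1, (hSF p (hJS p hp)).2.2⟩
  · rw [Finset.sum_map]
    exact hJ.le

/-- A set of positive packing measure splits, with masses at most `exp (-s n)`, into finitely many
small subsets of positive packing measure that are separated in the Bowen metrics `d_n`. -/
theorem exists_pmf_split [SecondCountableTopology X] {W : Type*} [PseudoMetricSpace W]
    [SecondCountableTopology W] {T : X → X} (hT : Continuous T) (φ : W → X) {s t : ℝ} (hst : s < t)
    {ε : ℝ} (hε : 0 < ε) {G : Set W} (hG : packingMeas T t ε (φ '' G) ≠ 0)
    (N : ℕ) {δ : ℝ} (hδ : 0 < δ) :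
    ∃ κ : PMF (Set W × ℕ × X), κ.support.Finite ∧
      (∀ y ∈ κ.support, y.1 ⊆ G ∧ packingMeas T t ε (φ '' y.1) ≠ 0 ∧ N ≤ y.2.1 ∧
        (∃ a, y.1 ⊆ Metric.ball a δ) ∧ κ y ≤ ENNReal.ofReal (Real.exp (-s * y.2.1))) ∧
      ∀ y ∈ κ.support, ∀ z ∈ κ.support, y ≠ z → ∀ u ∈ y.1, ∀ v ∈ z.1,
        ε < bowenDist T y.2.1 (φ u) (φ v) := by
  obtain ⟨J, hJ, hJd, hJs⟩ := exists_finset_pairwiseDisjoint T hst ε hG N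
  have hself : ∀ p : ℕ × X, p.2 ∈ closedBowenBall T p.1 p.2 ε := fun p => by
    simp [closedBowenBall, bowenDist_self, hε.le]
  obtain ⟨γ, hγ0, hγ⟩ : ∃ γ > 0, ∀ p ∈ J, ∀ q ∈ J, p ≠ q → ∀ u ∈ Metric.ball p.2 γ,
      ∀ v ∈ Metric.ball q.2 γ, ε < bowenDist T p.1 u v := by
    have hev : ∀ᶠ γ in 𝓝[>] (0 : ℝ), ∀ p ∈ J, ∀ q ∈ J, p ≠ q → ∀ u ∈ Metric.ball p.2 γ,
        ∀ v ∈ Metric.ball q.2 γ, ε < bowenDist T p.1 u v := by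
      refine (Finset.eventually_all J).2 fun p hp => (Finset.eventually_all J).2 fun q hq => ?_
      by_cases hpq : p = q
      · exact Eventually.of_forall fun _ h => absurd hpq h
      have hlt : ε < bowenDist T p.1 p.2 q.2 := by
        by_contra! hle
        exact Set.disjoint_left.1 (hJd hp hq hpq) (show q.2 ∈ _ from hle) (hself q)
      obtain ⟨γ, hγ, hball⟩ := Metric.mem_nhds_iff.1 (((isOpen_lt continuous_const
        (continuous_bowenDist hT p.1)).mem_nhds (show (p.2, q.2) ∈ {z : X × X | _ < _} from hlt)))
      filter_upwards [Ioc_mem_nhdsGT hγ] with γ' hγ' _ u hu v hv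
      have hmem : (u, v) ∈ Metric.ball p.2 γ ×ˢ Metric.ball q.2 γ := ⟨Metric.ball_subset_ball hγ'.2 hu, Metric.ball_subset_ball hγ'.2 hv⟩
      rw [ball_prod_same] at hmem
      exact hball hmem
    obtain ⟨γ, h1, h2⟩ := (hev.and self_mem_nhdsWithin).exists
    exact ⟨γ, h2, h1⟩
  -- Countably many `δ`-balls cover `W`, so by countable subadditivity one of them keeps positive
  -- packing measure near `p.2`.
  have hsmall : ∀ p ∈ J, ∃ G' : Set W, G' ⊆ G ∧ packingMeas T t ε (φ '' G') ≠ 0 ∧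
      φ '' G' ⊆ Metric.ball p.2 γ ∧ ∃ a, G' ⊆ Metric.ball a δ := by
    intro p hp
    have h0 := (hJ p hp).2 _ (Metric.ball_mem_nhds p.2 hγ0)
    obtain ⟨D, hD, hcov⟩ :=
      TopologicalSpace.countable_cover_nhds fun a : W => Metric.ball_mem_nhds a hδ
    obtain ⟨a, -, ha⟩ : ∃ a ∈ D, packingMeas T t ε
        (φ '' (G ∩ φ ⁻¹' Metric.ball p.2 γ ∩ Metric.ball a δ)) ≠ 0 := by
      by_contra! hall
      refine h0 (measure_mono_null (μ := packingOuterMeasure T t ε) ?_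
        ((measure_biUnion_null_iff hD).2 hall))
      rintro _ ⟨⟨w, hw, rfl⟩, hwb⟩
      obtain ⟨a, ha, hwa⟩ := Set.mem_iUnion₂.1 (hcov ▸ Set.mem_univ w : w ∈ ⋃ a ∈ D, _)
      exact Set.mem_biUnion ha ⟨w, ⟨⟨hw, hwb⟩, hwa⟩, rfl⟩
    refine ⟨_, fun w hw => hw.1.1, ha, ?_, a, Set.inter_subset_right⟩
    rintro _ ⟨w, hw, rfl⟩
    exact hw.1.2
  choose! g hgG hg0 hgb hgs using hsmall
  set f : ℕ × X → ℝ≥0∞ := (J : Set (ℕ × X)).indicator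
    fun p => ENNReal.ofReal (Real.exp (-s * p.1)) with hf
  have htsum : ∑' p, f p = ∑ p ∈ J, ENNReal.ofReal (Real.exp (-s * p.1)) := by
    rw [hf, ← tsum_subtype]
    exact Finset.tsum_subtype' J fun p : ℕ × X => ENNReal.ofReal (Real.exp (-s * p.1))
  have hf0 : ∑' p, f p ≠ 0 := by
    rw [htsum]
    exact (zero_lt_one.trans_le hJs).ne'
  have hftop : ∑' p, f p ≠ ∞ := by
    rw [htsum]
    exact ENNReal.sum_ne_top.2 fun p _ => ENNReal.ofReal_ne_top
  have hsupp : ∀ y ∈ ((PMF.normalize f hf0 hftop).map fun p => (g p, p)).support,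
      y.2 ∈ J ∧ y.1 = g y.2 := by
    intro y hy
    obtain ⟨p, hp, rfl⟩ := (PMF.mem_support_map_iff _ _ _).1 hy
    rw [PMF.mem_support_normalize_iff] at hp
    exact ⟨Set.mem_of_indicator_ne_zero hp, rfl⟩
  refine ⟨(PMF.normalize f hf0 hftop).map fun p => (g p, p), ?_, fun y hy => ?_, ?_⟩
  · refine (J.finite_toSet.image fun p => (g p, p)).subset fun y hy => ?_
    exact ⟨y.2, (hsupp y hy).1, Prod.ext (hsupp y hy).2.symm rfl⟩
  · obtain ⟨hyJ, hyg⟩ := hsupp y hy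
    rw [hyg]
    refine ⟨hgG _ hyJ, hg0 _ hyJ, (hJ _ hyJ).1, hgs _ hyJ, ?_⟩
    rw [PMF.map_apply, tsum_eq_single y.2]
    · split_ifs
      · rw [PMF.normalize_apply, htsum, hf, Set.indicator_of_mem (by exact hyJ)]
        -- Since the total weight is at least `1`, normalizing only lowers the weights.
        exact mul_le_of_le_one_right' (ENNReal.inv_le_one.2 hJs)
      · exact zero_le
    · intro p hp
      rw [if_neg]
      rintro rfl
      exact hp rfl
  · intro y hy z hz hyz u hu v hv
    obtain ⟨hyJ, hyg⟩ := hsupp y hy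
    obtain ⟨hzJ, hzg⟩ := hsupp z hz
    refine hγ _ hyJ _ hzJ (fun h => hyz ?_) _ (hgb _ hyJ ⟨u, hyg ▸ hu, rfl⟩) _
      (hgb _ hzJ ⟨v, hzg ▸ hv, rfl⟩)
    exact Prod.ext (by rw [hyg, hzg, h]) h

end Splitting

end PackingEntropy

/-! ### The tree of finitely supported measures. -/

/-- Mass arriving in `Q` can only come from points already in `Q`. -/
theorem PMF.toOuterMeasure_bind_le {α : Type*} (ν : PMF α) (κ : α → PMF α) {Q : Set α}
    (h : ∀ x ∈ ν.support, ∀ y ∈ (κ x).support, y ∈ Q → x ∈ Q) :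
    (ν.bind κ).toOuterMeasure Q ≤ ν.toOuterMeasure Q := by
  rw [PMF.toOuterMeasure_bind_apply, PMF.toOuterMeasure_apply]
  refine ENNReal.tsum_le_tsum fun x => ?_
  by_cases hxQ : x ∈ Q
  · rw [Set.indicator_of_mem hxQ]
    refine mul_le_of_le_one_right' ?_
    exact ((κ x).toOuterMeasure.mono (Set.subset_univ Q)).trans
      (((κ x).toOuterMeasure_apply_eq_one_iff _).2 (Set.subset_univ _)).le
  · rw [Set.indicator_of_notMem hxQ]
    by_cases hx : x ∈ ν.support
    · refine (mul_eq_zero_of_right _ ?_).le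
      rw [PMF.toOuterMeasure_apply_eq_zero_iff, Set.disjoint_left]
      exact fun y hy hyQ => hxQ (h x hx y hy hyQ)
    · rw [(ν.apply_eq_zero_iff x).2 hx, zero_mul]

namespace PackingEntropy

variable {X : Type*} [MetricSpace X] {W : Type*} {T : X → X} {φ : W → X}

/-- The pieces live in `W` rather than in `X` so that smallness in `W` can later produce a compact
set inside the range of `φ`. The last clause says that mass passes only from a piece to its subsets.
-/
theorem exists_pmf_tree [SecondCountableTopology X] [PseudoMetricSpace W]
    [SecondCountableTopology W] (hT : Continuous T) {s t : ℝ} (hst : s < t)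
    {ε : ℝ} (hε : 0 < ε) (hφ : packingMeas T t ε (Set.range φ) ≠ 0) :
    ∃ ν : ℕ → PMF (Set W × ℕ × X),
      (∀ p, (ν p).support.Finite) ∧
      (∀ p, ∀ y ∈ (ν p).support, y.1.Nonempty ∧ p ≤ y.2.1 ∧
        ν p y ≤ ENNReal.ofReal (Real.exp (-s * y.2.1))) ∧
      (∀ p, ∀ y ∈ (ν p).support, ∀ z ∈ (ν p).support, y ≠ z → ∀ u ∈ y.1, ∀ v ∈ z.1,
        ε < bowenDist T y.2.1 (φ u) (φ v)) ∧
      (∀ p, ∀ y ∈ (ν (p + 1)).support, (∃ a, y.1 ⊆ Metric.ball a (1 / (p + 1))) ∧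
        ∃ x ∈ (ν p).support, y.1 ⊆ x.1) ∧
      ∀ p, ∀ Q : Set (Set W × ℕ × X), (∀ x y, y.1 ⊆ x.1 → y ∈ Q → x ∈ Q) →
        (ν (p + 1)).toOuterMeasure Q ≤ (ν p).toOuterMeasure Q := by
  have hpos : ∀ G : Set W, packingMeas T t ε (φ '' G) ≠ 0 → G.Nonempty := by
    intro G hG
    rw [Set.nonempty_iff_ne_empty]
    rintro rfl
    rw [Set.image_empty] at hG
    exact hG (packingOuterMeasure T t ε).empty
  rw [← Set.image_univ] at hφ
  obtain ⟨w₀, -⟩ := hpos _ hφ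
  have : Inhabited X := ⟨φ w₀⟩
  -- The lower bound `x.2.1` lets children inherit the separation of their parents; `p + 1` makes
  -- the times tend to infinity.
  have hsplit := fun (x : Set W × ℕ × X) (p : ℕ) (hx : packingMeas T t ε (φ '' x.1) ≠ 0) =>
    exists_pmf_split hT φ hst hε hx (max x.2.1 (p + 1)) (Nat.one_div_pos_of_nat (α := ℝ) (n := p))
  choose! κ hκf hκ hκs using hsplit
  let ν : ℕ → PMF (Set W × ℕ × X) := fun p =>
    Nat.rec (PMF.pure (Set.univ, 0, φ w₀)) (fun p ν => ν.bind fun x => κ x p) p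
  have hν : ∀ p, ν (p + 1) = (ν p).bind fun x => κ x p := fun p => rfl
  have hsupp : ∀ p y, y ∈ (ν (p + 1)).support ↔ ∃ x ∈ (ν p).support, y ∈ (κ x p).support :=
    fun p y => by rw [hν, PMF.mem_support_bind_iff]
  have hgood : ∀ p, ∀ y ∈ (ν p).support, packingMeas T t ε (φ '' y.1) ≠ 0 := by
    intro p
    induction p with
    | zero =>
      intro y hy
      rw [(PMF.mem_support_pure_iff _ _).1 hy]
      exact hφ
    | succ p ih =>
      intro y hy
      obtain ⟨x, hx, hyx⟩ := (hsupp p y).1 hy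
      exact (hκ x p (ih x hx) y hyx).2.1
  have hle : ∀ p, ∀ x ∈ (ν p).support, ∀ y ∈ (κ x p).support, y.1 ⊆ x.1 := fun p x hx y hy =>
    (hκ x p (hgood p x hx) y hy).1
  refine ⟨ν, fun p => ?_, fun p y hy => ⟨hpos _ (hgood p y hy), ?_⟩, fun p => ?_,
    fun p y hy => ?_, fun p Q hQ => ?_⟩
  · induction p with
    | zero => exact (PMF.support_pure _).symm ▸ Set.finite_singleton _
    | succ p ih =>
      rw [hν, PMF.support_bind]
      exact ih.biUnion fun x hx => hκf x p (hgood p x hx)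
  · cases p with
    | zero =>
      rw [(PMF.mem_support_pure_iff _ _).1 hy]
      simpa using PMF.coe_le_one _ _
    | succ p =>
      constructor
      · obtain ⟨x, hx, hyx⟩ := (hsupp p y).1 hy
        exact (le_max_right _ _).trans (hκ x p (hgood p x hx) y hyx).2.2.1
      · rw [hν, PMF.bind_apply]
        calc ∑' x, ν p x * κ x p y
            ≤ ∑' x, ν p x * ENNReal.ofReal (Real.exp (-s * y.2.1)) := by
              refine ENNReal.tsum_le_tsum fun x => ?_
              by_cases hx : x ∈ (ν p).support
              · by_cases hyx : y ∈ (κ x p).support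
                · gcongr
                  exact (hκ x p (hgood p x hx) y hyx).2.2.2.2
                · rw [((κ x p).apply_eq_zero_iff y).2 hyx, mul_zero]
                  exact zero_le
              · rw [((ν p).apply_eq_zero_iff x).2 hx, zero_mul, zero_mul]
          _ = _ := by rw [ENNReal.tsum_mul_right, PMF.tsum_coe, one_mul]
  · induction p with
    | zero =>
      intro y hy z hz hyz
      exact absurd (((PMF.mem_support_pure_iff _ _).1 hy).trans
        ((PMF.mem_support_pure_iff _ _).1 hz).symm) hyz
    | succ p ih =>
      intro y hy z hz hyz u hu v hv
      obtain ⟨x, hx, hyx⟩ := (hsupp p y).1 hy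
      obtain ⟨x', hx', hzx'⟩ := (hsupp p z).1 hz
      by_cases hxx' : x = x'
      · subst hxx'
        exact hκs x p (hgood p x hx) y hyx z hzx' hyz u hu v hv
      -- Distinct parents are separated at the parent's time, and the Bowen distance grows with
      -- time.
      · refine (ih x hx x' hx' hxx' u (hle p x hx y hyx hu) v (hle p x' hx' z hzx' hv)).trans_le ?_
        exact bowenDist_mono T
          ((le_max_left _ _).trans (hκ x p (hgood p x hx) y hyx).2.2.1) _ _
  · obtain ⟨x, hx, hyx⟩ := (hsupp p y).1 hy
    exact ⟨(hκ x p (hgood p x hx) y hyx).2.2.2.1, x, hx, hle p x hx y hyx⟩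
  · rw [hν]
    exact PMF.toOuterMeasure_bind_le _ _ fun x hx y hy => hQ x y (hle p x hx y hy)

/-! ### The limit measure and the variational principle. -/

theorem exists_isCompact_le_upperEntropy [CompactSpace X] [MeasurableSpace X] [BorelSpace X]
    [MetricSpace W] [CompleteSpace W] [SecondCountableTopology W] (hT : Continuous T)
    (hφ : Continuous φ) {s t : ℝ≥0} (hst : s < t) {ε : ℝ} (hε : 0 < ε)
    (hφt : packingMeas T t ε (Set.range φ) ≠ 0) :
    ∃ K ⊆ Set.range φ, IsCompact K ∧ ∃ μ : ProbabilityMeasure X,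
      (μ : Measure X) K = 1 ∧ s ≤ upperEntropy T (μ : Measure X) := by
  obtain ⟨ν, hfin, hν, hsep, hchild, hdesc⟩ :=
    exists_pmf_tree hT (NNReal.coe_lt_coe.2 hst) hε hφt
  have hrefine : ∀ {p q}, p ≤ q → ∀ y ∈ (ν q).support, ∃ x ∈ (ν p).support, y.1 ⊆ x.1 := by
    intro p q hpq
    induction q, hpq using Nat.le_induction with
    | base => exact fun y hy => ⟨y, hy, subset_rfl⟩
    | succ q _ ih =>
      intro y hy
      obtain ⟨-, x, hx, hyx⟩ := hchild q y hy
      obtain ⟨x', hx', hxx'⟩ := ih x hx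
      exact ⟨x', hx', hyx.trans hxx'⟩
  obtain ⟨c, hc⟩ : ∃ c : Set W × ℕ × X → W, ∀ y, y.1.Nonempty → c y ∈ y.1 := by
    obtain ⟨y, hy⟩ := (ν 0).support_nonempty
    have : Nonempty W := (hν 0 y hy).1.to_type
    choose! c hc using fun (y : Set W × ℕ × X) (h : y.1.Nonempty) => h
    exact ⟨c, hc⟩
  have hc : ∀ p, ∀ y ∈ (ν p).support, c y ∈ y.1 := fun p y hy => hc y (hν p y hy).1
  -- One point is chosen in every piece. Each generation is finite and later pieces lie in small
  -- balls, so `A` is totally bounded; completeness of `W` makes its closure compact.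
  set A : Set W := ⋃ p, c '' (ν p).support
  have hAt : TotallyBounded A := by
    refine Metric.totallyBounded_iff.2 fun δ hδ => ?_
    obtain ⟨p, hp⟩ := exists_nat_one_div_lt hδ
    have : Nonempty W := ⟨c ((ν 0).support_nonempty.some)⟩
    choose! a ha using fun y hy => (hchild p y hy).1
    refine ⟨(⋃ q ∈ Set.Iic p, c '' (ν q).support) ∪ a '' (ν (p + 1)).support,
      ((Set.finite_Iic p).biUnion fun q _ => (hfin q).image c).union ((hfin _).image a), ?_⟩
    intro w hw
    obtain ⟨q, y, hy, rfl⟩ := Set.mem_iUnion.1 hw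
    rcases le_or_gt q p with hq | hq
    · exact Set.mem_biUnion (Or.inl (Set.mem_biUnion hq ⟨y, hy, rfl⟩)) (Metric.mem_ball_self hδ)
    · obtain ⟨x, hx, hyx⟩ := hrefine hq y hy
      exact Set.mem_biUnion (Or.inr ⟨x, hx, rfl⟩)
        (Metric.ball_subset_ball hp.le (ha x hx (hyx (hc q y hy))))
  have hK : IsCompact (φ '' closure A) :=
    (hAt.closure.isCompact_of_isClosed isClosed_closure).image hφ
  refine ⟨φ '' closure A, Set.image_subset_range _ _, hK, ?_⟩
  let μs : ℕ → ProbabilityMeasure X := fun p => ⟨((ν p).map (φ ∘ c)).toMeasure, inferInstance⟩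
  have hμs : ∀ p {B : Set X}, MeasurableSet B →
      (μs p : Measure X) B = (ν p).toOuterMeasure (φ ∘ c ⁻¹' B) := by
    intro p B hB
    rw [← PMF.toOuterMeasure_map_apply]
    exact PMF.toMeasure_apply_eq_toOuterMeasure_apply _ hB
  -- The space of probability measures is compact, so the sequence converges along an ultrafilter;
  -- the portmanteau inequalities hold along it.
  obtain ⟨μ, 𝒰, h𝒰, hμ⟩ : ∃ (μ : ProbabilityMeasure X) (𝒰 : Ultrafilter ℕ),
      (𝒰 : Filter ℕ) ≤ atTop ∧ Tendsto μs 𝒰 (𝓝 μ) :=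
    ⟨_, Ultrafilter.of atTop, Ultrafilter.of_le _, (Ultrafilter.map μs _).le_nhds_lim⟩
  have hclosed : ∀ {B : Set X} (p : ℕ), IsClosed B →
      (∀ q ≥ p, ∀ y ∈ (ν q).support, φ (c y) ∈ B) → (μ : Measure X) B = 1 := by
    intro B p hB h
    refine le_antisymm prob_le_one (le_trans (le_of_eq ?_)
      (ProbabilityMeasure.limsup_measure_closed_le_of_tendsto hμ hB))
    rw [limsup_congr (h𝒰 (Filter.mem_of_superset (Ici_mem_atTop p) fun q hq => ?_)), limsup_const]
    rw [Set.mem_ofPred_eq, hμs q hB.measurableSet, PMF.toOuterMeasure_apply_eq_one_iff]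
    exact h q hq
  have hopen : ∀ {B : Set X} {M : ℝ≥0∞} (p : ℕ), IsOpen B →
      (∀ q ≥ p, (ν q).toOuterMeasure (φ ∘ c ⁻¹' B) ≤ M) → (μ : Measure X) B ≤ M := by
    intro B M p hB h
    refine (ProbabilityMeasure.le_liminf_measure_open_of_tendsto hμ hB).trans ?_
    refine (liminf_le_limsup (by isBoundedDefault) (by isBoundedDefault)).trans
      (limsup_le_of_le (by isBoundedDefault) (h𝒰 (Filter.mem_of_superset (Ici_mem_atTop p) fun q hq => ?_)))
    rw [Set.mem_ofPred_eq, hμs q hB.measurableSet]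
    exact h q hq
  have hlocal : ∀ p, ∀ y ∈ (ν p).support, ∀ z ∈ closure (φ '' y.1),
      (μ : Measure X) (bowenBall T y.2.1 z ε) ≤ ENNReal.ofReal (Real.exp (-s * y.2.1)) := by
    intro p y hy z hz
    refine hopen p (isOpen_bowenBall hT _ z ε) fun q hq => ?_
    -- Pieces whose image meets the ball: a superset of such a piece is another, so the mass of `Q`
    -- does not increase with the generation.
    set Q : Set (Set W × ℕ × X) := {w | ∃ u ∈ w.1, φ u ∈ bowenBall T y.2.1 z ε}
    have hpq : (ν q).toOuterMeasure Q ≤ (ν p).toOuterMeasure Q := by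
      induction q, hq using Nat.le_induction with
      | base => exact le_rfl
      | succ q _ ih =>
        exact (hdesc q Q fun x y hyx ⟨u, hu, huB⟩ => ⟨u, hyx hu, huB⟩).trans ih
    calc (ν q).toOuterMeasure (φ ∘ c ⁻¹' bowenBall T y.2.1 z ε) ≤ (ν q).toOuterMeasure Q :=
          PMF.toOuterMeasure_mono _ fun w hw => ⟨c w, hc q w hw.2, hw.1⟩
      _ ≤ (ν p).toOuterMeasure Q := hpq
      _ ≤ (ν p).toOuterMeasure {y} := by
          -- In generation `p` only `y` meets the ball: if `w` had a point `u` there, approximating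
          -- `z` from `φ '' y.1` would give `v` in `y` at distance less than `ε` from `u`, against
          -- the separation.
          refine PMF.toOuterMeasure_mono _ fun w hw => ?_
          obtain ⟨⟨u, hu, huz⟩, hw⟩ := hw
          by_contra hwy
          have hnhds : IsOpen {z' | bowenDist T y.2.1 z' (φ u) < ε} :=
            isOpen_lt ((continuous_bowenDist hT _).comp (Continuous.prodMk_left _)) continuous_const
          obtain ⟨_, hv', v, hv, rfl⟩ := mem_closure_iff.1 hz _ hnhds huz
          exact lt_asymm hv' (hsep p y hy w hw (fun h => hwy h.symm) v hv u hu)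
      _ = ν p y := PMF.toOuterMeasure_apply_singleton _ _
      _ ≤ _ := (hν p y hy).2.2
  have hae : ∀ᵐ z ∂(μ : Measure X), ∀ p, z ∈ ⋃ y ∈ (ν p).support, closure (φ '' y.1) := by
    refine ae_all_iff.2 fun p => ?_
    have hcl : IsClosed (⋃ y ∈ (ν p).support, closure (φ '' y.1)) :=
      (hfin p).isClosed_biUnion fun _ _ => isClosed_closure
    refine (mem_ae_iff_prob_eq_one hcl.measurableSet).2 (hclosed p hcl fun q hq y hy => ?_)
    obtain ⟨x, hx, hyx⟩ := hrefine hq y hy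
    exact Set.mem_biUnion hx (subset_closure ⟨_, hyx (hc q y hy), rfl⟩)
  refine ⟨μ, hclosed 0 hK.isClosed fun q _ y hy => ?_, ?_⟩
  · exact ⟨_, subset_closure (Set.mem_iUnion.2 ⟨q, y, hy, rfl⟩), rfl⟩
  · calc (s : ℝ≥0∞) = ∫⁻ _, s ∂(μ : Measure X) := by simp
      _ ≤ upperEntropy T (μ : Measure X) := by
        refine lintegral_mono_ae ?_
        filter_upwards [hae] with z hz
        refine le_trans ?_ (le_iSup₂ (f := fun (ε : ℝ) (_ : 0 < ε) =>
          upperLocalEntropyAt T (μ : Measure X) z ε) ε hε)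
        refine le_limsup_of_frequently_le (frequently_atTop.2 fun N => ?_) (by isBoundedDefault)
        -- Generation `N + 1` gives a time at least `N` that is also nonzero, as division by it
        -- requires.
        obtain ⟨y, hy, hzy⟩ := Set.mem_iUnion₂.1 (hz (N + 1))
        have hN := (hν _ y hy).2.1
        exact ⟨y.2.1, by omega, coe_le_neg_log_div_of_le (by omega) (hlocal _ y hy z hzy)⟩

theorem exists_isCompact_le_upperEntropy_of_analyticSet {X : Type*} [MetricSpace X] [CompactSpace X]
    [MeasurableSpace X] [BorelSpace X] {T : X → X} (hT : Continuous T) {Z : Set X}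
    (hZ : AnalyticSet Z) {s : ℝ≥0} (hs : s < packingEntropy T Z) :
    ∃ K ⊆ Z, IsCompact K ∧ ∃ μ : ProbabilityMeasure X,
      (μ : Measure X) K = 1 ∧ s ≤ upperEntropy T (μ : Measure X) := by
  obtain ⟨W, _, _, φ, hφ, rfl⟩ := analyticSet_iff_exists_polishSpace_range.1 hZ
  let _ := TopologicalSpace.upgradeIsCompletelyMetrizable W
  obtain ⟨ε, hε⟩ := lt_iSup_iff.1 hs
  obtain ⟨hε0, hε⟩ := lt_iSup_iff.1 hε
  obtain ⟨t, hst, ht⟩ := ENNReal.lt_iff_exists_nnreal_btwn.1 hε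
  refine exists_isCompact_le_upperEntropy hT hφ (ENNReal.coe_lt_coe.1 hst) hε0 ?_
  rw [packingMeas_eq_top T ε _ t ht]
  exact ENNReal.top_ne_zero

end PackingEntropy

theorem theorem1p2 {X : Type*} [MetricSpace X] [CompactSpace X] [MeasurableSpace X] [BorelSpace X]
    (T : X → X) (hT : Continuous T) :
    (∀ K : Set X, K.Nonempty → IsCompact K →
      packingEntropy T K =
        ⨆ (μ : ProbabilityMeasure X) (_ : (μ : Measure X) K = 1), upperEntropy T (μ : Measure X)) ∧
    (∀ Z : Set X, AnalyticSet Z →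
      packingEntropy T Z = ⨆ (K : Set X) (_ : K ⊆ Z) (_ : IsCompact K), packingEntropy T K) ∧
    (∀ Z : Set X, MeasurableSet Z →
      packingEntropy T Z ≥
        ⨆ (μ : ProbabilityMeasure X) (_ : (μ : Measure X) Z = 1), upperEntropy T (μ : Measure X)) := by
  have hborel : ∀ Z : Set X, MeasurableSet Z → ⨆ (μ : ProbabilityMeasure X)
      (_ : (μ : Measure X) Z = 1), upperEntropy T (μ : Measure X) ≤ packingEntropy T Z :=
    fun Z hZ => iSup₂_le fun μ hμ => upperEntropy_le_packingEntropy hT _ hZ hμ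
  refine ⟨fun K _ hK => le_antisymm ?_ (hborel K hK.measurableSet), fun Z hZ => le_antisymm ?_ ?_,
    hborel⟩
  · refine ENNReal.le_of_forall_nnreal_lt fun s hs => ?_
    obtain ⟨K', hK', -, μ, hμ, hsμ⟩ :=
      exists_isCompact_le_upperEntropy_of_analyticSet hT hK.isClosed.analyticSet hs
    exact hsμ.trans (le_iSup₂_of_le μ
      (le_antisymm prob_le_one (hμ.symm.le.trans (measure_mono hK'))) le_rfl)
  · refine ENNReal.le_of_forall_nnreal_lt fun s hs => ?_
    obtain ⟨K, hKZ, hK, μ, hμ, hsμ⟩ := exists_isCompact_le_upperEntropy_of_analyticSet hT hZ hs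
    -- The covering inequality, applied to the compact carrier `K`, turns the entropy of `μ` back
    -- into packing entropy.
    exact (hsμ.trans (upperEntropy_le_packingEntropy hT _ hK.measurableSet hμ)).trans
      (le_iSup₂_of_le K hKZ (le_iSup_of_le hK le_rfl))
  · exact iSup₂_le fun K hKZ => iSup_le fun _ => packingEntropy_mono T hKZ
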